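/- Let $\tau\in\mathbb{C}$ with $\operatorname{Im}\tau>0$, and let $$\theta(u):=\sum_{\mu\in\frac12+\mathbb{Z}}\exp 2\pi i\Bigl(\mu\bigl(u+\tfrac12\bigr)+\frac{\mu^2}{2}\tau\Bigr)\qquad(u\in\mathbb{C})$$ be the odd Jacobi theta function. Put $Y_{r<s}:=1$ if $r<s$ and $Y_{r<s}:=0$ otherwise, and let $\delta_{r,s}$ be the Kronecker delta. Then for every integer $d\ge 1$ and all complex numbers $\hbar,u,\lambda_1,\dots,\lambda_d,\mu_1,\dots,\mu_d$, $$\det\left[\prod_{r=1}^d\theta\bigl(\mu_r-\lambda_{s'}+\hbar Y_{r<s}+\delta_{r,s}(u-(s-1)\hbar)\bigr)\right]_{s,s'=1,\dots,d} =\theta\Bigl(u+\sum_{r=1}^d(\mu_r-\lambda_r)\Bigr)\prod_{s=1}^{d-1}\theta(u-s\hbar)\prod_{1\le s<s'\le d}\theta(\lambda_{s'}-\lambda_s)\,\theta(\hbar+\mu_s-\mu_{s'}).$$ -/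

import Mathlib

/-- The theta series `θ_{m,l}(u,τ) = ∑_{μ ∈ m + lℤ} exp 2πi (μ u + μ² τ / (2l))`, with the
summation index written as `μ = m + l k`, `k ∈ ℤ` (a bijection onto `m + lℤ` for `l ≠ 0`). -/
noncomputable def thetaSeries (m l u τ : ℂ) : ℂ :=
  ∑' k : ℤ, Complex.exp (2 * Real.pi * Complex.I *
    ((m + l * k) * u + (m + l * k) ^ 2 / (2 * l) * τ))

/-- The odd Jacobi theta function `θ(u) = θ_{1/2,1}(u + 1/2, τ)`. -/
noncomputable def theta (τ u : ℂ) : ℂ :=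
  thetaSeries (1 / 2) 1 (u + 1 / 2) τ

/-- The matrix with entries
`∏_r θ(μ_r - λ_{s'} + ħ Y_{r<s} + δ_{r,s} (u - (s-1) ħ))`, where `Y_{r<s}` is `1` if `r < s` and
`0` otherwise. Indices in `Fin d` start at `0`, so that the number `s - 1` is `(s : ℂ)` here. -/
noncomputable def qFayMatrix (τ ħ u : ℂ) {d : ℕ} (lam mu : Fin d → ℂ) :
    Matrix (Fin d) (Fin d) ℂ :=
  Matrix.of fun s s' => ∏ r : Fin d,
    theta τ (mu r - lam s' + ħ * (if r < s then 1 else 0)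
      + (if r = s then 1 else 0) * (u - (s : ℕ) * ħ))

/-! In each variable λ_{s'} both sides are theta functions of degree d with the same multipliers
(`thetaSpace` with A = u + ∑ μ_r), and both are alternating in λ. At p = (z, μ_2, …, μ_d) the zero
of θ at 0 makes the matrix lower triangular, and the formula can be read off its diagonal
(`det_qFayMatrix_cons_tail`). By Fourier coefficients the space has dimension at most d. If the
value at p is nonzero, the rows therefore form a basis, and the points of p determine every function
in the space (`eq_zero_of_det_ne_zero`). The difference of the two sides then vanishes, one variable
at a time. The nonvanishing holds near, but not at, any given parameters along a suitable line, and
continuity gives the rest. -/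

/-! ### The odd theta function -/

open Complex in
theorem theta_eq_exp_mul_jacobiTheta₂ (τ u : ℂ) :
    theta τ u = exp (Real.pi * I * (u + 1 / 2 + τ / 4)) *
      jacobiTheta₂ (u + 1 / 2 + τ / 2) τ := by
  rw [theta, thetaSeries, jacobiTheta₂, ← tsum_mul_left]
  refine tsum_congr fun k => ?_
  rw [jacobiTheta₂_term, ← exp_add]
  congr 1
  ring

theorem differentiable_theta {τ : ℂ} (hτ : 0 < τ.im) : Differentiable ℂ (theta τ) := by
  have h : theta τ = fun u => Complex.exp (Real.pi * Complex.I * (u + 1 / 2 + τ / 4)) *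
      jacobiTheta₂ (u + 1 / 2 + τ / 2) τ := funext (theta_eq_exp_mul_jacobiTheta₂ τ)
  rw [h]
  intro u
  have h2 := (differentiableAt_jacobiTheta₂_fst (u + 1 / 2 + τ / 2) hτ).comp u
    (f := fun u : ℂ => u + 1 / 2 + τ / 2) (by fun_prop)
  exact DifferentiableAt.mul (by fun_prop) h2

open Complex in
theorem theta_add_one (τ u : ℂ) : theta τ (u + 1) = -theta τ u := by
  rw [theta_eq_exp_mul_jacobiTheta₂, theta_eq_exp_mul_jacobiTheta₂,
    show u + 1 + 1 / 2 + τ / 2 = (u + 1 / 2 + τ / 2) + 1 by ring, jacobiTheta₂_add_left,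
    show Real.pi * I * (u + 1 + 1 / 2 + τ / 4) = Real.pi * I * (u + 1 / 2 + τ / 4) + Real.pi * I
      by ring, exp_add, exp_pi_mul_I]
  ring

open Complex in
theorem theta_add_period (τ u : ℂ) :
    theta τ (u + τ) = -exp (-(Real.pi * I * τ) - 2 * Real.pi * I * u) * theta τ u := by
  rw [theta_eq_exp_mul_jacobiTheta₂, theta_eq_exp_mul_jacobiTheta₂,
    show u + τ + 1 / 2 + τ / 2 = (u + 1 / 2 + τ / 2) + τ by ring, jacobiTheta₂_add_left',
    ← mul_assoc, ← mul_assoc, ← exp_add, ← neg_one_mul (exp _), ← exp_pi_mul_I, ← exp_add,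
    ← exp_add]
  congr 1
  rw [exp_eq_exp_iff_exists_int]
  exact ⟨-1, by push_cast; ring⟩

open Complex in
theorem theta_neg (τ u : ℂ) : theta τ (-u) = -theta τ u := by
  have h : -u + 1 / 2 + τ / 2 = -((u + 1 / 2 + τ / 2) - τ - 1) := by ring
  have h2 := jacobiTheta₂_add_left ((u + 1 / 2 + τ / 2) - τ - 1) τ
  have h3 := jacobiTheta₂_add_left' ((u + 1 / 2 + τ / 2) - τ) τ
  rw [sub_add_cancel] at h2 h3
  rw [theta_eq_exp_mul_jacobiTheta₂, theta_eq_exp_mul_jacobiTheta₂, h, jacobiTheta₂_neg_left,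
    ← h2, h3, ← mul_assoc, ← exp_add, ← neg_mul, ← neg_one_mul (exp _), ← exp_pi_mul_I, ← exp_add]
  congr 1
  rw [exp_eq_exp_iff_exists_int]
  exact ⟨0, by push_cast; ring⟩

theorem theta_zero (τ : ℂ) : theta τ 0 = 0 := by
  have h := theta_neg τ 0
  rw [neg_zero] at h
  exact self_eq_neg.mp h

theorem theta_sub_one (τ u : ℂ) : theta τ (u - 1) = -theta τ u := by
  have h := theta_add_one τ (u - 1)
  rw [sub_add_cancel] at h
  rw [h, neg_neg]

open Complex in
theorem theta_sub_period (τ u : ℂ) :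
    theta τ (u - τ) = -exp (2 * Real.pi * I * u - Real.pi * I * τ) * theta τ u := by
  have h := theta_add_period τ (u - τ)
  rw [sub_add_cancel] at h
  rw [h, ← mul_assoc, neg_mul_neg, ← exp_add]
  ring_nf
  simp

-- Only the constant Fourier mode survives integration over a period. This shows that θ is not
-- identically zero.
open Complex MeasureTheory in
theorem integral_jacobiTheta₂ {τ : ℂ} (hτ : 0 < τ.im) :
    ∫ x in (0 : ℝ)..1, jacobiTheta₂ x τ = 1 := by
  let f : ℤ → C(ℝ, ℂ) := fun n =>
    ⟨fun x => jacobiTheta₂_term n x τ, by unfold jacobiTheta₂_term; fun_prop⟩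
  have hsum : Summable fun n => ‖(f n).restrict
      (⟨Set.uIcc (0 : ℝ) 1, isCompact_uIcc⟩ : TopologicalSpace.Compacts ℝ)‖ := by
    have h0 := ((summable_jacobiTheta₂_term_iff 0 τ).mpr hτ).norm
    refine h0.of_nonneg_of_le (fun _ => norm_nonneg _) fun n => ?_
    refine (ContinuousMap.norm_le _ (norm_nonneg _)).mpr fun x => ?_
    simp [f, norm_jacobiTheta₂_term]
  have h := intervalIntegral.hasSum_intervalIntegral_of_summable_norm hsum
  have hterm : ∀ n : ℤ, ∫ x in (0 : ℝ)..1, f n x = if n = 0 then 1 else 0 := by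
    intro n
    by_cases hn : n = 0
    · simp [f, hn, jacobiTheta₂_term]
    · rw [if_neg hn]
      have hc : (2 * Real.pi * I * n : ℂ) ≠ 0 := by
        simp [Real.pi_ne_zero, hn]
      have : ∀ x : ℝ, f n x = exp (2 * Real.pi * I * n * x) * exp (Real.pi * I * n ^ 2 * τ) := by
        intro x
        simp [f, jacobiTheta₂_term, exp_add]
      simp_rw [this]
      rw [intervalIntegral.integral_mul_const, integral_exp_mul_complex hc]
      have h1 : exp (2 * Real.pi * I * n * (1 : ℝ)) = 1 := by
        rw [exp_eq_one_iff]
        exact ⟨n, by push_cast; ring⟩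
      rw [h1]
      simp
  simp_rw [hterm] at h
  have h2 := h.unique (hasSum_ite_eq 0 1)
  simpa [f, jacobiTheta₂] using h2

theorem exists_theta_ne_zero {τ : ℂ} (hτ : 0 < τ.im) : ∃ u, theta τ u ≠ 0 := by
  by_contra! h
  have h0 : ∀ z, jacobiTheta₂ z τ = 0 := by
    intro z
    have := theta_eq_exp_mul_jacobiTheta₂ τ (z - 1 / 2 - τ / 2)
    rw [h, show z - 1 / 2 - τ / 2 + 1 / 2 + τ / 2 = z by ring] at this
    exact (mul_eq_zero.mp this.symm).resolve_left (Complex.exp_ne_zero _)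
  have := integral_jacobiTheta₂ hτ
  simp [h0] at this

open Filter Topology in
theorem eventually_theta_ne_zero {τ : ℂ} (hτ : 0 < τ.im) (a : ℂ) {b : ℂ} (hb : b ≠ 0) :
    ∀ᶠ t in 𝓝[≠] (0 : ℂ), theta τ (a + t * b) ≠ 0 := by
  have hd : Differentiable ℂ fun t => theta τ (a + t * b) :=
    (differentiable_theta hτ).comp (by fun_prop)
  have han : AnalyticOnNhd ℂ (fun t => theta τ (a + t * b)) Set.univ :=
    fun t _ => hd.analyticAt t
  rcases (hd.analyticAt 0).eventually_eq_zero_or_eventually_ne_zero with h | h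
  · obtain ⟨v, hv⟩ := exists_theta_ne_zero hτ
    have h0 := han.eqOn_zero_of_preconnected_of_eventuallyEq_zero isPreconnected_univ
      (Set.mem_univ 0) h (Set.mem_univ ((v - a) / b))
    refine absurd ?_ hv
    simpa [div_mul_cancel₀ _ hb] using h0
  · exact h

/-! ### Theta functions of degree d and their dimension -/

open Complex in
/-- Theta functions of degree `d`: entire functions with multipliers `(-1) ^ d` along `1` and
`(-1) ^ d * exp (2πi (A - d x) - πi d τ)` along `τ`. -/
noncomputable def thetaSpace (τ : ℂ) (d : ℕ) (A : ℂ) : Submodule ℂ (ℂ → ℂ) where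
  carrier := {f | Differentiable ℂ f ∧ (∀ x, f (x + 1) = (-1) ^ d * f x) ∧
    ∀ x, f (x + τ) =
      (-1) ^ d * exp (2 * Real.pi * I * (A - d * x) - Real.pi * I * d * τ) * f x}
  add_mem' := by
    rintro f g ⟨hf, hf1, hf2⟩ ⟨hg, hg1, hg2⟩
    refine ⟨hf.add hg, fun x => ?_, fun x => ?_⟩
    · simp only [Pi.add_apply, hf1, hg1]; ring
    · simp only [Pi.add_apply, hf2, hg2]; ring
  zero_mem' := ⟨differentiable_const 0, by simp, by simp⟩
  smul_mem' := by
    rintro c f ⟨hf, hf1, hf2⟩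
    refine ⟨hf.const_smul c, fun x => ?_, fun x => ?_⟩
    · simp only [Pi.smul_apply, hf1, smul_eq_mul]; ring
    · simp only [Pi.smul_apply, hf2, smul_eq_mul]; ring

open Complex in
theorem prod_theta_mem_thetaSpace {τ : ℂ} (hτ : 0 < τ.im) {d : ℕ} (a : Fin d → ℂ) {A : ℂ}
    (hA : ∑ r, a r = A) : (fun x => ∏ r, theta τ (a r - x)) ∈ thetaSpace τ d A := by
  refine ⟨?_, fun x => ?_, fun x => ?_⟩
  · have h : ∀ r, Differentiable ℂ fun x => theta τ (a r - x) := fun r =>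
      (differentiable_theta hτ).comp (by fun_prop)
    fun_prop
  · simp only [← sub_sub, theta_sub_one, Finset.prod_neg, Finset.card_univ, Fintype.card_fin]
  · simp only [← sub_sub, theta_sub_period, Finset.prod_mul_distrib, Finset.prod_neg,
      Finset.card_univ, Fintype.card_fin, ← exp_sum]
    congr 3
    simp only [Finset.sum_sub_distrib, ← Finset.mul_sum, hA]
    simp
    ring

-- Periodicity absorbs the real part of the shift. For the imaginary part, Cauchy's theorem applies
-- to a rectangle whose vertical sides cancel.
open Complex in
theorem integral_add_eq_of_periodic {h : ℂ → ℂ} (hd : Differentiable ℂ h)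
    (hp : ∀ x, h (x + 1) = h x) (w : ℂ) :
    ∫ x in (0 : ℝ)..1, h (x + w) = ∫ x in (0 : ℝ)..1, h x := by
  have hper : Function.Periodic (fun x : ℝ => h (x + w.im * I)) 1 := by
    intro x
    simp only [ofReal_add, ofReal_one]
    rw [add_right_comm, hp]
  have h1 : ∫ x in (0 : ℝ)..1, h (x + w) = ∫ x in (0 : ℝ)..1, h (x + w.im * I) := by
    have h2 := hper.intervalIntegral_add_eq w.re 0
    have h3 := intervalIntegral.integral_comp_add_right (a := 0) (b := 1)
      (fun x : ℝ => h (x + w.im * I)) w.re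
    rw [zero_add, add_comm 1] at h3
    rw [zero_add, ← h3] at h2
    rw [← h2]
    refine intervalIntegral.integral_congr fun x _ => ?_
    simp only [ofReal_add]
    rw [add_assoc, re_add_im]
  rw [h1]
  have h3 := integral_boundary_rect_eq_zero_of_differentiableOn h 0 (1 + w.im * I)
    hd.differentiableOn
  simp only [zero_re, add_re, one_re, mul_re, ofReal_re, I_re, mul_zero, ofReal_im, I_im,
    mul_one, sub_self, add_zero, zero_im, ofReal_zero, zero_mul, add_im, one_im, mul_im,
    zero_add, ofReal_one] at h3
  have h4 : ∀ y : ℝ, h (1 + y * I) = h (y * I) := fun y => by rw [add_comm, hp]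
  simp only [h4, add_sub_cancel_right] at h3
  exact (sub_eq_zero.mp h3).symm

theorem eq_zero_of_integral_mul_exp_eq_zero {g : ℝ → ℂ} (hg : Continuous g)
    (hp : Function.Periodic g 1)
    (h : ∀ n : ℤ, ∫ x in (0 : ℝ)..1, g x * Complex.exp (-(2 * Real.pi * Complex.I * n * x)) = 0)
    (x : ℝ) : g x = 0 := by
  let G : C(UnitAddCircle, ℂ) := ⟨hp.lift, continuous_coinduced_dom.mpr hg⟩
  have hc : fourierCoeff G = 0 := by
    funext n
    rw [fourierCoeff_eq_intervalIntegral _ n 0, Pi.zero_apply]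
    simp only [div_one, one_smul, zero_add, ← h n]
    refine intervalIntegral.integral_congr fun y _ => ?_
    simp only [fourier_coe_apply, smul_eq_mul, mul_comm (g y)]
    congr 1
    · congr 1
      push_cast
      ring
  have hs := has_pointwise_sum_fourier_series_of_summable (f := G)
    (by rw [hc]; exact summable_zero) (x : UnitAddCircle)
  simp only [hc, Pi.zero_apply, zero_smul] at hs
  exact hs.unique hasSum_zero

open Complex in
/-- The `n`-th Fourier coefficient of the periodic function `exp (πi d x) * f x`. -/
noncomputable def thetaCoeff (d : ℕ) (n : ℤ) (f : ℂ → ℂ) : ℂ :=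
  ∫ x in (0 : ℝ)..1, f x * exp (Real.pi * I * (d - 2 * n) * x)

-- Moving the contour by τ brings in the factor exp(-2πi d x), which raises the Fourier index by d.
open Complex in
theorem thetaCoeff_add_degree {τ A : ℂ} {d : ℕ} {f : ℂ → ℂ} (hf : f ∈ thetaSpace τ d A) (n : ℤ) :
    ∃ c : ℂ, c ≠ 0 ∧ thetaCoeff d n f = c * thetaCoeff d (n + d) f := by
  obtain ⟨hd, h1, h2⟩ := hf
  refine ⟨(-1) ^ d * exp (2 * Real.pi * I * (A - n * τ)), by simp [exp_ne_zero], ?_⟩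
  have key := integral_add_eq_of_periodic (h := fun x => f x * exp (Real.pi * I * (d - 2 * n) * x))
    (by fun_prop) (fun x => ?_) τ
  · rw [thetaCoeff, ← key, thetaCoeff, ← intervalIntegral.integral_const_mul]
    refine intervalIntegral.integral_congr fun x _ => ?_
    simp only [h2]
    have he : exp (2 * Real.pi * I * (A - d * x) - Real.pi * I * d * τ) *
        exp (Real.pi * I * (d - 2 * n) * (x + τ)) = exp (2 * Real.pi * I * (A - n * τ)) *
        exp (Real.pi * I * (d - 2 * (n + d : ℤ)) * x) := by
      rw [← exp_add, ← exp_add]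
      push_cast
      ring_nf
    linear_combination ((-1) ^ d * f x) * he
  · rw [h1, mul_add, exp_add]
    have : exp (Real.pi * I * (d - 2 * n) * 1) = (-1) ^ d := by
      rw [← exp_pi_mul_I, ← exp_nat_mul, exp_eq_exp_iff_exists_int]
      exact ⟨-n, by push_cast; ring⟩
    rw [this]
    have h3 : ((-1 : ℂ) ^ d) * (-1) ^ d = 1 := by rw [← mul_pow]; simp
    linear_combination (f x * exp (Real.pi * I * (d - 2 * n) * x)) * h3

open Complex in
theorem eq_zero_of_thetaCoeff_eq_zero {τ A : ℂ} {d : ℕ} (hd0 : 0 < d) {f : ℂ → ℂ}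
    (hf : f ∈ thetaSpace τ d A) (h : ∀ i : Fin d, thetaCoeff d (i : ℕ) f = 0) : f = 0 := by
  have hiff : ∀ n : ℤ, thetaCoeff d n f = 0 ↔ thetaCoeff d (n + d) f = 0 := by
    intro n
    obtain ⟨c, hc, h⟩ := thetaCoeff_add_degree hf n
    rw [h, mul_eq_zero, or_iff_right hc]
  have hmul : ∀ n k : ℤ, thetaCoeff d n f = 0 ↔ thetaCoeff d (n + d * k) f = 0 := by
    intro n k
    induction k using Int.induction_on with
    | zero => simp
    | succ k ih => rw [ih, hiff, mul_add, mul_one, add_assoc]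
    | pred k ih => rw [ih, hiff (n + d * (-k - 1)), mul_sub, mul_one, add_assoc, sub_add_cancel]
  have hall : ∀ n : ℤ, thetaCoeff d n f = 0 := by
    intro n
    have hdz : (0 : ℤ) < d := by exact_mod_cast hd0
    have hlt := Int.emod_lt_of_pos n hdz
    have hnn := Int.emod_nonneg n hdz.ne'
    rw [← Int.emod_add_mul_ediv n d, ← hmul]
    have := h ⟨(n % d).toNat, by omega⟩
    rwa [show (((⟨(n % d).toNat, by omega⟩ : Fin d) : ℕ) : ℤ) = n % d from
      Int.toNat_of_nonneg hnn] at this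
  obtain ⟨hd, h1, -⟩ := hf
  have hreal : ∀ x : ℝ, f x * exp (Real.pi * I * d * x) = 0 := by
    refine eq_zero_of_integral_mul_exp_eq_zero ?_ ?_ ?_
    · have := hd.continuous
      fun_prop
    · intro x
      have : exp (Real.pi * I * d * 1) = (-1) ^ d := by
        rw [← exp_pi_mul_I, ← exp_nat_mul]
        ring_nf
      have h3 : ((-1 : ℂ) ^ d) * (-1) ^ d = 1 := by rw [← mul_pow]; simp
      simp only [ofReal_add, ofReal_one, h1, mul_add, exp_add, this]
      linear_combination (f x * exp (Real.pi * I * d * x)) * h3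
    · intro n
      rw [← hall n, thetaCoeff]
      refine intervalIntegral.integral_congr fun x _ => ?_
      rw [mul_assoc, ← exp_add]
      ring_nf
  -- The real zeros accumulate at 0, so the identity theorem applies.
  have han : AnalyticOnNhd ℂ f Set.univ := fun z _ => hd.analyticAt z
  have hfreq : ∃ᶠ z in nhdsWithin (0 : ℂ) {0}ᶜ, f z = 0 := by
    have ht : Filter.Tendsto (fun x : ℝ => (x : ℂ)) (nhdsWithin 0 {0}ᶜ)
        (nhdsWithin (0 : ℂ) {0}ᶜ) := by
      refine tendsto_nhdsWithin_iff.mpr ⟨?_, ?_⟩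
      · exact (continuous_ofReal.tendsto' 0 0 (by simp)).mono_left nhdsWithin_le_nhds
      · filter_upwards [self_mem_nhdsWithin] with x hx
        simpa using hx
    refine ht.frequently (Filter.Eventually.frequently (Filter.Eventually.of_forall fun x => ?_))
    exact (mul_eq_zero.mp (hreal x)).resolve_right (exp_ne_zero _)
  funext z
  exact han.eqOn_zero_of_preconnected_of_frequently_eq_zero isPreconnected_univ
    (Set.mem_univ 0) hfreq (Set.mem_univ z)

open Complex in
/-- The Fourier coefficients with index `0, …, d - 1`, as a linear map on theta functions. -/
noncomputable def thetaCoeffLinearMap (τ A : ℂ) (d : ℕ) :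
    thetaSpace τ d A →ₗ[ℂ] (Fin d → ℂ) where
  toFun f i := thetaCoeff d (i : ℕ) f
  map_add' f g := by
    funext i
    have hf := f.2.1.continuous
    have hg := g.2.1.continuous
    simp only [thetaCoeff, Pi.add_apply, Submodule.coe_add, add_mul]
    refine intervalIntegral.integral_add ?_ ?_ <;>
      exact Continuous.intervalIntegrable (by fun_prop) _ _
  map_smul' c f := by
    funext i
    simp only [thetaCoeff, Pi.smul_apply, Submodule.coe_smul, smul_eq_mul, mul_assoc,
      RingHom.id_apply]
    exact intervalIntegral.integral_const_mul _ _

theorem thetaCoeffLinearMap_injective (τ A : ℂ) {d : ℕ} (hd : 0 < d) :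
    Function.Injective (thetaCoeffLinearMap τ A d) := by
  rw [injective_iff_map_eq_zero]
  intro f hf
  exact Subtype.ext (eq_zero_of_thetaCoeff_eq_zero hd f.2 fun i => congrFun hf i)

/-- Points at which some `d` theta functions of degree `d` have a nonsingular matrix of values
determine all theta functions of that degree. -/
theorem eq_zero_of_det_ne_zero {τ A : ℂ} {d : ℕ} (hd : 0 < d) (g : Fin d → ℂ → ℂ)
    (hg : ∀ s, g s ∈ thetaSpace τ d A) (p : Fin d → ℂ)
    (hdet : (Matrix.of fun s s' => g s (p s')).det ≠ 0) {f : ℂ → ℂ} (hf : f ∈ thetaSpace τ d A)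
    (h0 : ∀ j, f (p j) = 0) : f = 0 := by
  have hinj := thetaCoeffLinearMap_injective τ A hd
  have : FiniteDimensional ℂ (thetaSpace τ d A) := FiniteDimensional.of_injective _ hinj
  have hle : Module.finrank ℂ (thetaSpace τ d A) ≤ d := by
    simpa using LinearMap.finrank_le_finrank_of_injective hinj
  let ev : thetaSpace τ d A →ₗ[ℂ] (Fin d → ℂ) :=
    { toFun := fun f j => (f : ℂ → ℂ) (p j)
      map_add' := fun _ _ => rfl
      map_smul' := fun _ _ => rfl }
  have hli : LinearIndependent ℂ fun s => ev ⟨g s, hg s⟩ :=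
    Matrix.linearIndependent_rows_of_det_ne_zero hdet
  have hli' : LinearIndependent ℂ fun s => (⟨g s, hg s⟩ : thetaSpace τ d A) :=
    LinearIndependent.of_comp ev hli
  -- The `g s` are d independent elements in dimension at most d, so evaluation at `p` is an
  -- isomorphism once it is onto.
  have heq : Module.finrank ℂ (thetaSpace τ d A) = Module.finrank ℂ (Fin d → ℂ) := by
    have := hli'.fintype_card_le_finrank
    simp at this ⊢
    omega
  have hsurj : Function.Surjective ev := by
    rw [← LinearMap.range_eq_top, eq_top_iff,
      ← hli.span_eq_top_of_card_eq_finrank' (by simp), Submodule.span_le]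
    rintro _ ⟨s, rfl⟩
    exact ⟨_, rfl⟩
  have hinj' := (LinearMap.injective_iff_surjective_of_finrank_eq_finrank heq).mpr hsurj
  have := (injective_iff_map_eq_zero ev).mp hinj' ⟨f, hf⟩ (funext h0)
  exact congrArg Subtype.val this

/-! ### Symmetry and quasi-periodicity of the two sides -/

/-- The product side of the determinant formula. -/
noncomputable def qFayProduct (τ ħ u : ℂ) {d : ℕ} (lam mu : Fin d → ℂ) : ℂ :=
  theta τ (u + ∑ r : Fin d, (mu r - lam r)) *
    (∏ s ∈ Finset.Icc 1 (d - 1), theta τ (u - (s : ℂ) * ħ)) *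
    ∏ s : Fin d, ∏ s' ∈ Finset.Ioi s,
      (theta τ (lam s' - lam s) * theta τ (ħ + mu s - mu s'))

theorem det_qFayMatrix_perm (τ ħ u : ℂ) {d : ℕ} (lam mu : Fin d → ℂ) (σ : Equiv.Perm (Fin d)) :
    (qFayMatrix τ ħ u (lam ∘ σ) mu).det =
      ((Equiv.Perm.sign σ : ℤ) : ℂ) * (qFayMatrix τ ħ u lam mu).det :=
  Matrix.det_permute' σ (qFayMatrix τ ħ u lam mu)

theorem qFayProduct_perm (τ ħ u : ℂ) {d : ℕ} (lam mu : Fin d → ℂ) (σ : Equiv.Perm (Fin d)) :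
    qFayProduct τ ħ u (lam ∘ σ) mu =
      ((Equiv.Perm.sign σ : ℤ) : ℂ) * qFayProduct τ ħ u lam mu := by
  have h := σ.prod_Ioi_comp_eq_sign_mul_prod (f := fun i j => theta τ (lam j - lam i))
    fun i j => by rw [← theta_neg, neg_sub]
  simp only [qFayProduct, Finset.prod_mul_distrib, Function.comp_apply, h,
    Finset.sum_sub_distrib, Equiv.sum_comp σ lam]
  ring

theorem det_qFayMatrix_eq_zero_of_eq (τ ħ u : ℂ) {d : ℕ} {lam : Fin d → ℂ} (mu : Fin d → ℂ)
    {i j : Fin d} (hij : i ≠ j) (h : lam i = lam j) : (qFayMatrix τ ħ u lam mu).det = 0 :=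
  Matrix.det_zero_of_column_eq hij fun s => by simp only [qFayMatrix, Matrix.of_apply, h]

theorem qFayProduct_eq_zero_of_eq (τ ħ u : ℂ) {d : ℕ} {lam : Fin d → ℂ} (mu : Fin d → ℂ)
    {i j : Fin d} (hij : i ≠ j) (h : lam i = lam j) : qFayProduct τ ħ u lam mu = 0 := by
  wlog hlt : i < j generalizing i j
  · exact this hij.symm h.symm (lt_of_le_of_ne (not_lt.mp hlt) hij.symm)
  refine mul_eq_zero_of_right _ (Finset.prod_eq_zero (Finset.mem_univ i)
    (Finset.prod_eq_zero (Finset.mem_Ioi.mpr hlt) ?_))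
  rw [h, sub_self, theta_zero, zero_mul]

/-- The `s` shifts by ħ cancel the diagonal term -sħ, so A is the same for all rows. -/
theorem qFayMatrix_row_mem_thetaSpace {τ : ℂ} (hτ : 0 < τ.im) (ħ u : ℂ) {d : ℕ}
    (mu : Fin d → ℂ) (s : Fin d) :
    (fun x => ∏ r : Fin d, theta τ (mu r - x + ħ * (if r < s then 1 else 0)
      + (if r = s then 1 else 0) * (u - (s : ℕ) * ħ))) ∈ thetaSpace τ d (u + ∑ r, mu r) := by
  have h := prod_theta_mem_thetaSpace hτ (fun r => mu r + ħ * (if r < s then 1 else 0)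
    + (if r = s then 1 else 0) * (u - (s : ℕ) * ħ)) (A := u + ∑ r, mu r) ?_
  · convert h using 4
    ring
  · have hcard : ∑ r : Fin d, (if r < s then (1 : ℂ) else 0) = (s : ℕ) := by
      rw [Finset.sum_boole]
      congr 1
      rw [← Fin.card_Iio s]
      congr 1
      ext r
      simp
    rw [Finset.sum_add_distrib, Finset.sum_add_distrib, ← Finset.mul_sum, hcard]
    simp
    ring

theorem det_qFayMatrix_cons_mem_thetaSpace {τ : ℂ} (hτ : 0 < τ.im) (ħ u : ℂ) {n : ℕ}
    (mu : Fin (n + 1) → ℂ) (y : Fin n → ℂ) :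
    (fun x => (qFayMatrix τ ħ u (Fin.cons x y) mu).det) ∈
      thetaSpace τ (n + 1) (u + ∑ r, mu r) := by
  have h : (fun x => (qFayMatrix τ ħ u (Fin.cons x y) mu).det) =
      ∑ s : Fin (n + 1), ((-1) ^ (s : ℕ) *
        ((qFayMatrix τ ħ u (Fin.cons 0 y) mu).submatrix s.succAbove Fin.succ).det) •
        fun x => ∏ r, theta τ (mu r - x + ħ * (if r < s then 1 else 0)
          + (if r = s then 1 else 0) * (u - (s : ℕ) * ħ)) := by
    funext x
    rw [Matrix.det_succ_column_zero, Finset.sum_apply]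
    refine Finset.sum_congr rfl fun s _ => ?_
    rw [Pi.smul_apply, smul_eq_mul, mul_right_comm]
    rfl
  rw [h]
  exact Submodule.sum_mem _ fun s _ =>
    Submodule.smul_mem _ _ (qFayMatrix_row_mem_thetaSpace hτ ħ u mu s)

/-- Exactly n + 1 factors involve x: θ(y_j - x) for each j, and θ(u + ∑ μ_r - ∑ y_j - x), whose
shifts add up to A. -/
theorem qFayProduct_cons_mem_thetaSpace {τ : ℂ} (hτ : 0 < τ.im) (ħ u : ℂ) {n : ℕ}
    (mu : Fin (n + 1) → ℂ) (y : Fin n → ℂ) :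
    (fun x => qFayProduct τ ħ u (Fin.cons x y) mu) ∈ thetaSpace τ (n + 1) (u + ∑ r, mu r) := by
  have h := Submodule.smul_mem _ ((∏ s ∈ Finset.Icc 1 n, theta τ (u - (s : ℂ) * ħ)) *
      (∏ s : Fin (n + 1), ∏ s' ∈ Finset.Ioi s, theta τ (ħ + mu s - mu s')) *
      ∏ s : Fin n, ∏ s' ∈ Finset.Ioi s, theta τ (y s' - y s))
    (prod_theta_mem_thetaSpace hτ (Fin.cons (u + ∑ r, mu r - ∑ j, y j) y : Fin (n + 1) → ℂ)
      (A := u + ∑ r, mu r) (by simp [Fin.sum_univ_succ]))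
  convert h using 1
  funext x
  simp only [qFayProduct, Finset.prod_mul_distrib, Pi.smul_apply, smul_eq_mul,
    add_tsub_cancel_right, Finset.sum_sub_distrib]
  rw [Fin.prod_univ_succ (fun r => theta τ ((Fin.cons _ y : Fin (n + 1) → ℂ) r - x)),
    Fin.prod_univ_succ (fun s => ∏ s' ∈ Finset.Ioi s,
      theta τ ((Fin.cons x y : Fin (n + 1) → ℂ) s' - (Fin.cons x y : Fin (n + 1) → ℂ) s)),
    Fin.sum_univ_succ (fun s => (Fin.cons x y : Fin (n + 1) → ℂ) s)]
  simp only [Fin.prod_Ioi_zero, Fin.prod_Ioi_succ, Fin.cons_zero, Fin.cons_succ]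
  rw [show u + (∑ r, mu r - (x + ∑ j, y j)) = u + ∑ r, mu r - ∑ j, y j - x by ring]
  ring

/-! ### Interpolation from the triangular specialisation -/

/-- An alternating function of `n + 1` variables whose slices are theta functions of degree
`n + 1` vanishes as soon as it vanishes at a tuple of points that determines theta functions. -/
theorem eq_zero_of_alternating_of_apply_eq_zero {τ A : ℂ} {n : ℕ} {F : (Fin (n + 1) → ℂ) → ℂ}
    (hslice : ∀ y : Fin n → ℂ, (fun x => F (Fin.cons x y)) ∈ thetaSpace τ (n + 1) A)
    (hperm : ∀ x (σ : Equiv.Perm (Fin (n + 1))), F x = 0 → F (x ∘ σ) = 0)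
    (heq : ∀ x i j, i ≠ j → x i = x j → F x = 0) {p : Fin (n + 1) → ℂ}
    (hp : ∀ f ∈ thetaSpace τ (n + 1) A, (∀ j, f (p j) = 0) → f = 0) (hFp : F p = 0)
    (x : Fin (n + 1) → ℂ) : F x = 0 := by
  -- `S` holds the coordinates that are free; the others are entries of `p`, possibly repeated.
  suffices h : ∀ S : Finset (Fin (n + 1)), ∀ x, (∀ i ∉ S, ∃ j, x i = p j) → F x = 0 from
    h Finset.univ x fun i hi => absurd (Finset.mem_univ i) hi
  intro S
  induction S using Finset.induction_on with
  | empty =>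
    intro x hx
    choose φ hφ using fun i => hx i (Finset.notMem_empty i)
    by_cases hinj : Function.Injective φ
    · have := hperm p (Equiv.ofBijective φ hinj.bijective_of_finite) hFp
      rwa [show x = p ∘ Equiv.ofBijective φ hinj.bijective_of_finite from funext hφ]
    · simp only [Function.Injective, not_forall] at hinj
      obtain ⟨i, j, hij, hne⟩ := hinj
      exact heq x i j hne (by rw [hφ, hφ, hij])
  | insert i S _ ih =>
    intro x hx
    let y : Fin n → ℂ := Fin.tail (x ∘ Equiv.swap 0 i)
    have hupd : ∀ z, Fin.cons z y ∘ Equiv.swap 0 i = Function.update x i z := by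
      intro z
      have h1 : (Fin.cons z y : Fin (n + 1) → ℂ) =
          Function.update (x ∘ Equiv.swap 0 i) 0 z := by
        rw [← Fin.cons_self_tail (x ∘ Equiv.swap 0 i), Fin.update_cons_zero]
      rw [h1]
      funext k
      simp only [Function.comp_apply, Function.update_apply, Equiv.swap_apply_eq_iff,
        Equiv.swap_apply_left, Equiv.swap_apply_self]
    have hz := hp _ (hslice y) fun j => by
      have hj : F (Function.update x i (p j)) = 0 := by
        refine ih _ fun k hk => ?_
        by_cases hki : k = i
        · exact ⟨j, by simp [hki]⟩
        · rw [Function.update_of_ne hki]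
          exact hx k (by simp [hki, hk])
      have := hperm _ (Equiv.swap 0 i) hj
      rw [← hupd] at this
      convert this using 2
      funext k
      simp
    have h0 := hperm _ (Equiv.swap 0 i) (congrFun hz (x i))
    simp only [hupd, Function.update_eq_self] at h0
    exact h0

/-- Above the diagonal the factor r = s' is θ(0). In the diagonal entries, the factors r = s give
the terms with u, and each pair of distinct indices gives one θ(λ_{s'} - λ_s) and one θ(ħ + μ_s -
μ_{s'}). -/
theorem det_qFayMatrix_cons_tail (τ ħ u : ℂ) {n : ℕ} (mu : Fin (n + 1) → ℂ) (z : ℂ) :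
    (qFayMatrix τ ħ u (Fin.cons z (Fin.tail mu)) mu).det =
      qFayProduct τ ħ u (Fin.cons z (Fin.tail mu)) mu := by
  set p : Fin (n + 1) → ℂ := Fin.cons z (Fin.tail mu) with hpdef
  have hp : ∀ s, s ≠ 0 → p s = mu s := by
    intro s hs
    obtain ⟨j, rfl⟩ := Fin.exists_succ_eq.mpr hs
    simp [hpdef, Fin.tail]
  have htri : (qFayMatrix τ ħ u p mu).IsLowerTriangular := by
    intro s s' hlt
    have hlt : s < s' := hlt
    refine Finset.prod_eq_zero (Finset.mem_univ s') ?_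
    rw [hp s' (Fin.ne_zero_of_lt hlt), if_neg hlt.not_gt, if_neg hlt.ne']
    simp [theta_zero]
  let E : Fin (n + 1) → Fin (n + 1) → ℂ := fun r s =>
    theta τ (mu r - p s + ħ * (if r < s then 1 else 0)
      + (if r = s then 1 else 0) * (u - (s : ℕ) * ħ))
  have hdiag : ∏ s, E s s = theta τ (u + ∑ r, (mu r - p r)) *
      ∏ s ∈ Finset.Icc 1 n, theta τ (u - (s : ℂ) * ħ) := by
    rw [Fin.prod_univ_succ, Fin.sum_univ_succ]
    congr 1
    · simp [E, hpdef, Fin.tail, add_comm]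
    · rw [← Finset.Ico_succ_right_eq_Icc, Finset.prod_Ico_eq_prod_range, Finset.prod_range]
      simp [E, hpdef, Fin.tail, add_comm]
      rfl
  rw [Matrix.det_of_isLowerTriangular _ htri, qFayProduct, add_tsub_cancel_right, ← hdiag]
  have hsplit : ∀ s, qFayMatrix τ ħ u p mu s s = E s s * ∏ r ∈ {s}ᶜ, E r s := fun s =>
    (Fintype.prod_eq_mul_prod_compl s fun r => E r s)
  rw [Finset.prod_congr rfl fun s _ => hsplit s, Finset.prod_mul_distrib,
    ← Finset.prod_prod_Ioi_mul_eq_prod_prod_off_diag]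
  congr 1
  refine Finset.prod_congr rfl fun s _ => Finset.prod_congr rfl fun s' hs' => ?_
  have hlt : s < s' := Finset.mem_Ioi.mp hs'
  have hs0 := hp s' (Fin.ne_zero_of_lt hlt)
  simp only [E, hs0, hlt, hlt.not_gt, hlt.ne, hlt.ne', if_true, if_false]
  congr 2 <;> ring

theorem det_qFayMatrix_eq_qFayProduct_of_ne_zero {τ : ℂ} (hτ : 0 < τ.im) (ħ u : ℂ) {n : ℕ}
    (lam mu : Fin (n + 1) → ℂ) (z : ℂ)
    (hz : qFayProduct τ ħ u (Fin.cons z (Fin.tail mu)) mu ≠ 0) :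
    (qFayMatrix τ ħ u lam mu).det = qFayProduct τ ħ u lam mu := by
  rw [← sub_eq_zero]
  refine eq_zero_of_alternating_of_apply_eq_zero (τ := τ) (A := u + ∑ r, mu r)
    (F := fun x => (qFayMatrix τ ħ u x mu).det - qFayProduct τ ħ u x mu)
    (p := Fin.cons z (Fin.tail mu)) (fun y => ?_) (fun x σ h => ?_) (fun x i j hij h => ?_)
    (fun f hf h0 => ?_) ?_ lam
  · exact Submodule.sub_mem _ (det_qFayMatrix_cons_mem_thetaSpace hτ ħ u mu y)
      (qFayProduct_cons_mem_thetaSpace hτ ħ u mu y)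
  · rw [det_qFayMatrix_perm, qFayProduct_perm, ← mul_sub, h, mul_zero]
  · rw [det_qFayMatrix_eq_zero_of_eq τ ħ u mu hij h, qFayProduct_eq_zero_of_eq τ ħ u mu hij h,
      sub_zero]
  · rw [← det_qFayMatrix_cons_tail] at hz
    exact eq_zero_of_det_ne_zero n.succ_pos _ (qFayMatrix_row_mem_thetaSpace hτ ħ u mu) _ hz hf h0
  · exact sub_eq_zero.mpr (det_qFayMatrix_cons_tail τ ħ u mu z)

/-! ### Generic nonvanishing and the limit -/

open Filter Topology in
/-- Along a suitable line through given parameters, the product side at the triangular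
specialisation is nonzero off a discrete set. -/
theorem eventually_qFayProduct_ne_zero {τ : ℂ} (hτ : 0 < τ.im) (ħ u : ℂ) {n : ℕ}
    (mu : Fin (n + 1) → ℂ) :
    ∀ᶠ t in 𝓝[≠] (0 : ℂ), qFayProduct τ (ħ + t * (n + 1)) (u + t * (-1))
      (Fin.cons (t * (-2)) (Fin.tail fun r => mu r + t * (r : ℕ)))
      (fun r => mu r + t * (r : ℕ)) ≠ 0 := by
  -- The directions are chosen so that every theta argument has nonzero slope in t: 1, -(1 +
  -- s(n+1)), n+1+s-s', s'-s and s+2 respectively.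
  have h1 : ∀ᶠ t in 𝓝[≠] (0 : ℂ), theta τ ((u + mu 0) + t * 1) ≠ 0 :=
    eventually_theta_ne_zero hτ _ one_ne_zero
  have h2 : ∀ᶠ t in 𝓝[≠] (0 : ℂ), ∀ s ∈ Finset.Icc 1 n,
      theta τ ((u - s * ħ) + t * (-((1 + s * (n + 1) : ℕ) : ℂ))) ≠ 0 := by
    rw [Finset.eventually_all]
    exact fun s _ => eventually_theta_ne_zero hτ _
      (neg_ne_zero.mpr (Nat.cast_ne_zero.mpr (by omega)))
  have h3 : ∀ᶠ t in 𝓝[≠] (0 : ℂ), ∀ s s' : Fin (n + 1), s < s' →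
      theta τ ((ħ + mu s - mu s') + t * ((n + 1 + s - s' : ℕ) : ℂ)) ≠ 0 := by
    simp only [eventually_all]
    exact fun s s' _ => eventually_theta_ne_zero hτ _ (Nat.cast_ne_zero.mpr (by omega))
  have h4 : ∀ᶠ t in 𝓝[≠] (0 : ℂ), ∀ s s' : Fin (n + 1), s < s' →
      theta τ ((mu s' - mu s) + t * ((s' - s : ℕ) : ℂ)) ≠ 0 := by
    simp only [eventually_all]
    exact fun s s' h => eventually_theta_ne_zero hτ _ (Nat.cast_ne_zero.mpr (by omega))
  have h5 : ∀ᶠ t in 𝓝[≠] (0 : ℂ), ∀ s : Fin (n + 1),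
      theta τ (mu s + t * ((s + 2 : ℕ) : ℂ)) ≠ 0 := by
    simp only [eventually_all]
    exact fun s => eventually_theta_ne_zero hτ _ (Nat.cast_ne_zero.mpr (by omega))
  filter_upwards [h1, h2, h3, h4, h5] with t h1 h2 h3 h4 h5
  rw [qFayProduct]
  refine mul_ne_zero (mul_ne_zero ?_ ?_) ?_
  · convert h1 using 2
    rw [Fin.sum_univ_succ]
    simp [Fin.tail]
    ring
  · refine Finset.prod_ne_zero_iff.mpr fun s hs => ?_
    convert h2 s hs using 2
    push_cast
    ring
  · refine Finset.prod_ne_zero_iff.mpr fun s _ => Finset.prod_ne_zero_iff.mpr fun s' hs' => ?_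
    have hlt : s < s' := Finset.mem_Ioi.mp hs'
    refine mul_ne_zero ?_ ?_
    · obtain ⟨k, rfl⟩ := Fin.exists_succ_eq.mpr (Fin.ne_zero_of_lt hlt)
      rcases Fin.eq_zero_or_eq_succ s with rfl | ⟨j, rfl⟩
      · convert h5 k.succ using 2
        simp [Fin.tail]
        ring
      · convert h4 j.succ k.succ hlt using 2
        rw [Nat.cast_sub (Fin.lt_def.mp hlt).le]
        simp only [Fin.cons_succ, Fin.tail]
        ring
    · convert h3 s s' hlt using 2
      rw [Nat.cast_sub (by omega)]
      push_cast
      ring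

theorem lemma1 (τ : ℂ) (hτ : 0 < τ.im) (d : ℕ) (hd : 1 ≤ d) (ħ u : ℂ) (lam mu : Fin d → ℂ) :
    (qFayMatrix τ ħ u lam mu).det =
      theta τ (u + ∑ r : Fin d, (mu r - lam r)) *
        (∏ s ∈ Finset.Icc 1 (d - 1), theta τ (u - (s : ℂ) * ħ)) *
        ∏ s : Fin d, ∏ s' ∈ Finset.Ioi s,
          (theta τ (lam s' - lam s) * theta τ (ħ + mu s - mu s')) := by
  obtain ⟨n, rfl⟩ := Nat.exists_eq_succ_of_ne_zero (Nat.one_le_iff_ne_zero.mp hd)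
  have hθ : Continuous (theta τ) := (differentiable_theta hτ).continuous
  let L : ℂ → ℂ := fun t => (qFayMatrix τ (ħ + t * (n + 1)) (u + t * (-1)) lam
    fun r => mu r + t * (r : ℕ)).det
  let R : ℂ → ℂ := fun t => qFayProduct τ (ħ + t * (n + 1)) (u + t * (-1)) lam
    fun r => mu r + t * (r : ℕ)
  have hL : Continuous L := by
    refine Continuous.matrix_det (continuous_matrix fun s s' => ?_)
    simp only [qFayMatrix, Matrix.of_apply]
    fun_prop
  have hR : Continuous R := by
    simp only [R, qFayProduct]
    fun_prop
  have hev : L =ᶠ[nhdsWithin 0 {0}ᶜ] R := by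
    filter_upwards [eventually_qFayProduct_ne_zero hτ ħ u mu] with t ht
    exact det_qFayMatrix_eq_qFayProduct_of_ne_zero hτ _ _ lam _ _ ht
  have h0 : L 0 = R 0 := tendsto_nhds_unique_of_eventuallyEq
    (hL.continuousAt.tendsto.mono_left nhdsWithin_le_nhds)
    (hR.continuousAt.tendsto.mono_left nhdsWithin_le_nhds) hev
  simpa [L, R, qFayProduct] using h0
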